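/- Theorem 3.1 (uniqueness of a recurrent eigenfunction). Let $E$ be a Lusin space (homeomorphic to a Borel subset of a compact metric space) with Borel $\sigma$-algebra, and let $X=(\Omega,(X_t)_{t\ge 0},(\theta_t)_{t\ge 0},(\mathbb P_x)_{x\in E})$ be a conservative Borel right process on $E$: a time-homogeneous, right-continuous process with $\mathbb P_x(X_0=x)=1$, with Borel transition function, with shift operators $\theta_t$ satisfying $X_s\circ\theta_t=X_{s+t}$, with values in $E$ at all times, and strong Markov with respect to a right-continuous filtration to which it is adapted. Let $\mathcal F_t$ be the augmentation of $\sigma(X_s, s\le t)$ by the null sets of all initial laws. Let $(S_t)_{t\ge 0}$ be a strictly positive semimartingale multiplicative functional of $X$: $S$ is adapted to $(\mathcal F_t)$ and is a semimartingale under every $\mathbb P_x$, $S_0=1$, $S_t>0$ for all $t\ge0$, $S_{t-}>0$ for all $t>0$, and $S_{t+s}=S_t\cdot(S_s\circ\theta_t)$ for all $s,t\ge0$ (all almost surely under every $\mathbb P_x$); assume moreover that $\mathbb E_x[S_t]<\infty$ for all $t>0$ and $x\in E$. Let $\mathscr P_tf(x)=\mathbb E_x[S_tf(X_t)]$. Call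 a Borel function $\pi:E\to(0,\infty)$ a recurrent eigenfunction if (a) there is $\lambda\in\mathbb R$ with $\mathscr P_t\pi(x)=e^{-\lambda t}\pi(x)$ for all $t>0$ and $x\in E$; and (b) $X$ is recurrent under the eigen-measure $\mathbb Q^\pi$, which is given on each $\mathcal F_t$ by $\mathbb Q^\pi_x|_{\mathcal F_t}=e^{\lambda t}\frac{\pi(X_t)}{\pi(X_0)}S_t\,\mathbb P_x|_{\mathcal F_t}$. That is, for every universally measurable $B\subseteq E$, the potential $$R^\pi(x,B)=\int_0^\infty \mathbb Q^\pi_x(X_t\in B)\,dt$$ is either $0$ for all $x\in E$ or $\infty$ for all $x\in E$. Then a recurrent eigenfunction is unique up to a multiplicative constant: if $\pi_1,\pi_2$ are recurrent eigenfunctions, possibly with different $\lambda_1,\lambda_2$, there is a constant $c>0$ with $\pi_2=c\,\pi_1$ on $E$. -/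

import Mathlib

open MeasureTheory ProbabilityTheory Filter Topology Set
open scoped NNReal ENNReal

noncomputable section

universe u v

/-! ### State space -/

/-- A Lusin topological space: a space homeomorphic to a Borel subset of a compact metric space. -/
def IsLusinSpace (E : Type v) [TopologicalSpace E] : Prop :=
  ∃ (K : Type v) (_ : MetricSpace K) (_ : CompactSpace K) (f : E → K),
    IsEmbedding f ∧ MeasurableSet[borel K] (range f)

/-- Universally measurable sets: those lying in the completion of the Borel σ-algebra under every
probability measure. -/
def IsUniversallyMeasurable {E : Type v} [MeasurableSpace E] (B : Set E) : Prop :=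
  ∀ μ : Measure E, IsProbabilityMeasure μ → NullMeasurableSet B μ

/-! ### Borel right processes -/

/-- The filtration `𝓕⁰_t = σ(X_s, s ≤ t)`. -/
def naturalFiltration {Ω : Type u} {E : Type v} [mΩ : MeasurableSpace Ω] [mE : MeasurableSpace E]
    (X : ℝ≥0 → Ω → E) (hX : ∀ t, Measurable (X t)) : Filtration ℝ≥0 mΩ where
  seq t := ⨆ s ≤ t, mE.comap (X s)
  mono' _ _ hst := biSup_mono fun _ h => h.trans hst
  le' _ := iSup₂_le fun s _ => (hX s).comap_le

/-- A conservative Borel right process `(Ω, 𝓕⁰_∞, (X_t), (θ_t), (P_x)_{x ∈ E})` on the Lusin space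
`E`. The σ-algebra carried by `Ω` is `𝓕⁰_∞ = σ(X_s, s ≥ 0)`; its completions, and the augmented
filtration, are built from it below. Conservativeness is built in: `P_x` is a probability measure
and `X_t` takes its values in `E`, without a cemetery.

A process is strong Markov for some right-continuous admissible filtration if and only if it is so
for the smallest one, `𝓕⁰_{t+} = ⋂_{r > t} 𝓕⁰_r`, which is the one used here. -/
structure BorelRightProcess (Ω : Type u) (E : Type v) [mΩ : MeasurableSpace Ω]
    [TopologicalSpace E] [mE : MeasurableSpace E] where
  /-- The process. -/
  X : ℝ≥0 → Ω → E
  /-- The laws `P_x`; that `x ↦ P_x Λ` is Borel for `Λ ∈ 𝓕⁰_∞` is part of being a kernel. -/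
  P : Kernel E Ω
  /-- The shift operators. -/
  θ : ℝ≥0 → Ω → Ω
  lusin : IsLusinSpace E
  borelSpace : BorelSpace E
  isMarkovKernel : IsMarkovKernel P
  measurable_X : ∀ t, Measurable (X t)
  generated : mΩ = ⨆ t, mE.comap (X t)
  /-- Normality. -/
  normal : ∀ x, ∀ᵐ ω ∂(P x), X 0 ω = x
  X_shift : ∀ s t ω, X s (θ t ω) = X (s + t) ω
  rightContinuous : ∀ ω t, ContinuousWithinAt (fun s => X s ω) (Ici t) t
  /-- The strong Markov property `P_μ(X_{σ+s} ∈ B | 𝓕⁰_{σ+}) = P_{X_σ}(X_s ∈ B)`, `P_μ`-a.s. on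
  `{σ < ∞}`, where `P_μ = ∫ P_x μ(dx)` is `μ.bind P`. -/
  strongMarkov : ∀ (σ : Ω → WithTop ℝ≥0)
    (hσ : IsStoppingTime (naturalFiltration X measurable_X).rightCont σ)
    (μ : Measure E), IsProbabilityMeasure μ → ∀ (s : ℝ≥0) (B : Set E), MeasurableSet B →
    (μ.bind P)⟦{ω | X ((σ ω).untopD 0 + s) ω ∈ B} | hσ.measurableSpace⟧
      =ᵐ[(μ.bind P).restrict {ω | σ ω < ⊤}]
        fun ω => (P (X ((σ ω).untopD 0) ω)).real {ω' | X s ω' ∈ B}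

/-! ### Semimartingales -/

/-- Right-continuous with left limits. -/
def IsCadlag (f : ℝ≥0 → ℝ) : Prop :=
  (∀ t, ContinuousWithinAt f (Ici t) t) ∧ ∀ t, ∃ l, Tendsto f (𝓝[<] t) (𝓝 l)

/-- Càdlàg local martingales. -/
structure IsLocalMartingale {Ω : Type u} {mΩ : MeasurableSpace Ω} (ℱ : Filtration ℝ≥0 mΩ)
    (μ : Measure Ω) (M : ℝ≥0 → Ω → ℝ) : Prop where
  adapted : Adapted ℱ M
  cadlag : ∀ᵐ ω ∂μ, IsCadlag fun t => M t ω
  local_martingale : Locally (fun N => Martingale N ℱ μ) ℱ M μ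

/-- Càdlàg adapted processes of finite variation on compact time intervals. -/
structure IsFiniteVariation {Ω : Type u} {mΩ : MeasurableSpace Ω} (ℱ : Filtration ℝ≥0 mΩ)
    (μ : Measure Ω) (A : ℝ≥0 → Ω → ℝ) : Prop where
  adapted : Adapted ℱ A
  cadlag : ∀ᵐ ω ∂μ, IsCadlag fun t => A t ω
  finite_variation : ∀ᵐ ω ∂μ, LocallyBoundedVariationOn (fun t => A t ω) univ

/-- Semimartingales: sums of a local martingale and a process of finite variation (which absorbs
the initial value), up to indistinguishability. -/
structure IsSemimartingale {Ω : Type u} {mΩ : MeasurableSpace Ω} (ℱ : Filtration ℝ≥0 mΩ)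
    (μ : Measure Ω) (Z : ℝ≥0 → Ω → ℝ) : Prop where
  adapted : Adapted ℱ Z
  cadlag : ∀ᵐ ω ∂μ, IsCadlag fun t => Z t ω
  decomposition : ∃ M A : ℝ≥0 → Ω → ℝ, IsLocalMartingale ℱ μ M ∧ IsFiniteVariation ℱ μ A ∧
    ∀ᵐ ω ∂μ, ∀ t, Z t ω = M t ω + A t ω

/-- The `μ`-completion `σ(𝓕_t, 𝓝)` of a filtration, `𝓝` being the null sets of the `μ`-completion
of the ambient σ-algebra. It is a filtration of the completed measurable space. -/
def completedFiltration {Ω : Type u} {mΩ : MeasurableSpace Ω} (ℱ : Filtration ℝ≥0 mΩ)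
    (μ : Measure Ω) :
    Filtration ℝ≥0 (inferInstance : MeasurableSpace (NullMeasurableSpace Ω μ)) where
  seq t := @eventuallyMeasurableSpace Ω (ℱ t) (ae μ) inferInstance
  mono' _ _ hst := fun _ ⟨A, hA, h⟩ => ⟨A, ℱ.mono hst A hA, h⟩
  le' t := fun _ ⟨A, hA, h⟩ => ⟨A, ℱ.le t A hA, h⟩

/-! ### The pricing kernel -/

namespace BorelRightProcess

variable {Ω : Type u} {E : Type v} [mΩ : MeasurableSpace Ω] [TopologicalSpace E]
  [mE : MeasurableSpace E] (Y : BorelRightProcess Ω E)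

/-- `𝓕⁰_t = σ(X_s, s ≤ t)`. -/
def filtration : Filtration ℝ≥0 mΩ := naturalFiltration Y.X Y.measurable_X

/-- The minimum augmented admissible filtration `𝓕_t = ⋂_μ 𝓕_t^μ`, where `μ` runs through the
probability measures on `E` and `𝓕_t^μ` is the `P_μ`-completion of `𝓕⁰_t`. -/
@[reducible] def augmented (t : ℝ≥0) : MeasurableSpace Ω :=
  ⨅ (μ : Measure E) (_ : IsProbabilityMeasure μ),
    (completedFiltration Y.filtration (μ.bind Y.P)).seq t

/-- Strictly positive semimartingale multiplicative functionals `S` of the process with `S_0 = 1`,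
strictly positive left limits and finite expectations. As usual, identities between random
variables are almost sure under every `P_x`. For each `x`, the process `S` is a
`P_x`-semimartingale on the filtered probability space completed under `P_x`. -/
structure IsPricingKernel (S : ℝ≥0 → Ω → ℝ) : Prop where
  adapted : ∀ t, Measurable[Y.augmented t] (S t)
  semimartingale : ∀ x, IsSemimartingale (completedFiltration Y.filtration (Y.P x))
    (Y.P x).completion S
  multiplicative : ∀ s t x, ∀ᵐ ω ∂(Y.P x), S (t + s) ω = S t ω * S s (Y.θ t ω)
  zero : ∀ x, ∀ᵐ ω ∂(Y.P x), S 0 ω = 1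
  pos : ∀ x, ∀ᵐ ω ∂(Y.P x), ∀ t, 0 < S t ω
  leftLimit_pos : ∀ x, ∀ᵐ ω ∂(Y.P x), ∀ t, 0 < t →
    ∃ l, 0 < l ∧ Tendsto (fun s => S s ω) (𝓝[<] t) (𝓝 l)
  integrable : ∀ t x, 0 < t → Integrable (S t) (Y.P x)

/-- The pricing operators `𝒫_t f (x) = E_x[S_t f(X_t)]`. -/
def pricing (S : ℝ≥0 → Ω → ℝ) (t : ℝ≥0) (f : E → ℝ) (x : E) : ℝ :=
  ∫ ω, S t ω * f (Y.X t ω) ∂(Y.P x)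

/-- `π` is a strictly positive finite Borel function with `𝒫_t π = e^{-λt} π` for all `t > 0`. -/
structure IsPositiveEigenfunction (S : ℝ≥0 → Ω → ℝ) (lam : ℝ) (π : E → ℝ) : Prop where
  measurable : Measurable π
  pos : ∀ x, 0 < π x
  integrable : ∀ t x, 0 < t → Integrable (fun ω => S t ω * π (Y.X t ω)) (Y.P x)
  eigen : ∀ t x, 0 < t → Y.pricing S t π x = Real.exp (-lam * t) * π x

/-! ### Eigen-measures and recurrence -/

/-- The process `M^π_t = e^{λt} (π(X_t) / π(X_0)) S_t`. -/
def eigenMartingale (S : ℝ≥0 → Ω → ℝ) (lam : ℝ) (π : E → ℝ) (t : ℝ≥0) (ω : Ω) : ℝ :=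
  Real.exp (lam * t) * (π (Y.X t ω) / π (Y.X 0 ω)) * S t ω

/-- The eigen-measure `Q^π_x` up to time `t`: the measure `M^π_t P_x`, to be read on `𝓕_t`. -/
def eigenMeasure (S : ℝ≥0 → Ω → ℝ) (lam : ℝ) (π : E → ℝ) (t : ℝ≥0) (x : E) : Measure Ω :=
  (Y.P x).withDensity fun ω => ENNReal.ofReal (Y.eigenMartingale S lam π t ω)

/-- The transition function of the process under the eigen-measure,
`Q^π_t(x, B) = Q^π_x(X_t ∈ B)`. -/
def eigenTransition (S : ℝ≥0 → Ω → ℝ) (lam : ℝ) (π : E → ℝ) (t : ℝ≥0) (x : E) : Measure E :=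
  (Y.eigenMeasure S lam π t x).map (Y.X t)

end BorelRightProcess

/-- The potential (Green's measure) `R(x, B) = ∫_0^∞ Q_t(x, B) dt` of a transition function. For a
universally measurable set `B` the value `Q_t(x, B)` is that of the completed measure. -/
def potential {E : Type v} [MeasurableSpace E] (Q : ℝ≥0 → E → Measure E) (x : E) (B : Set E) :
    ℝ≥0∞ :=
  ∫⁻ t in Ici (0 : ℝ), Q t.toNNReal x B

/-- Recurrence: every universally measurable set `B` has potential `R(·, B)` identically `0` or
identically `∞`. -/
def IsRecurrent {E : Type v} [MeasurableSpace E] (Q : ℝ≥0 → E → Measure E) : Prop :=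
  ∀ B : Set E, IsUniversallyMeasurable B →
    (∀ x, potential Q x B = 0) ∨ (∀ x, potential Q x B = ∞)

/-- `π` is a positive eigenfunction of the pricing operators, for some real `λ`, and the process is
recurrent under the eigen-measure `Q^π`. -/
def BorelRightProcess.IsRecurrentEigenfunction {Ω : Type u} {E : Type v} [MeasurableSpace Ω]
    [TopologicalSpace E] [MeasurableSpace E] (Y : BorelRightProcess Ω E) (S : ℝ≥0 → Ω → ℝ)
    (π : E → ℝ) : Prop :=
  ∃ lam : ℝ, Y.IsPositiveEigenfunction S lam π ∧ IsRecurrent (Y.eigenTransition S lam π)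

end

/-! Order the eigenvalues so that `lam₁ ≤ lam₂` and put h = π₂/π₁. Under the eigen-measure of π₁ the
transition operators Q_t are the Doob π₁-transform of the pricing operators, so Q_t h = exp(-(lam₂ -
lam₁)t) h (`lintegral_eigenTransition_div`). Thus h is a positive supermedian function of a
recurrent Markov semigroup, and such a function must be constant (`eq_of_isRecurrent`); the
eigenvalues then agree as well.

Constancy is proved with potentials alone, without convergence of supermartingales along paths. If g
is bounded and supermedian, the potential of the set where g exceeds Q_t g by more than ε is finite,
because s ↦ Q_s g decreases and the drops telescope (`potential_drop_ne_top`). Recurrence turns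
finite into zero, so Q_s g does not depend on s > 0 (`lintegral_eq_of_supermedian`). Applied to the
truncations of h, this gives a point y such that {h ≠ h(y)} has potential zero at y, hence
everywhere.

The probabilistic input is the semigroup law of the pricing operators (`lpricing_lpricing`), which
follows from multiplicativity of S and the Markov property for shifts (`setLIntegral_theta`). -/

noncomputable section

universe u v

/-! ### Invariant functions of recurrent transition semigroups -/

/-- Markov transition semigroups whose operators map Borel functions to universally measurable
functions. -/
structure IsMarkovSemigroup {E : Type*} [MeasurableSpace E] (Q : ℝ≥0 → E → Measure E) : Prop where
  -- Only positive times occur: the eigenvalue equation, which yields total mass one, is assumed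
  -- only there.
  prob : ∀ s x, 0 < s → IsProbabilityMeasure (Q s x)
  aemeasurable : ∀ s, 0 < s → ∀ F : E → ℝ≥0∞, Measurable F → ∀ μ : Measure E,
    IsProbabilityMeasure μ → AEMeasurable (fun y => ∫⁻ z, F z ∂(Q s y)) μ
  comp : ∀ s t x, 0 < s → 0 < t → ∀ F : E → ℝ≥0∞, Measurable F →
    ∫⁻ y, ∫⁻ z, F z ∂(Q t y) ∂(Q s x) = ∫⁻ z, F z ∂(Q (s + t) x)

/-! ### Estimates for potentials -/

section Recurrent

variable {E : Type*} [MeasurableSpace E] {Q : ℝ≥0 → E → Measure E}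

/-- If a > b, then Q_s(x, N) would be at least (a - b)/c throughout (0, r), forcing a positive
potential. Only a constant lower bound is integrated, so no measurability in s is needed. -/
theorem le_of_potential_eq_zero {x : E} {N : Set E} (h : potential Q x N = 0) {r : ℝ≥0}
    (hr : 0 < r) {a b c : ℝ≥0∞} (hc : c ≠ ∞)
    (H : ∀ s, 0 < s → s < r → a ≤ b + c * Q s x N) : a ≤ b := by
  by_contra! hab
  have hδ : (a - b) / c ≠ 0 := (ENNReal.div_pos (tsub_pos_of_lt hab).ne' hc).ne'
  have key : ∫⁻ _ in Ioo (0 : ℝ) r, (a - b) / c ≤ potential Q x N := by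
    refine (setLIntegral_mono' measurableSet_Ioo fun s hs => ?_).trans
      (lintegral_mono_set (Ioo_subset_Ico_self.trans Ico_subset_Ici_self))
    refine ENNReal.div_le_of_le_mul' (tsub_le_iff_left.2 (H _ (Real.toNNReal_pos.2 hs.1) ?_))
    exact Real.toNNReal_lt_iff_lt_coe hs.1.le |>.2 hs.2
  rw [h, setLIntegral_const, Real.volume_Ioo, nonpos_iff_eq_zero, mul_eq_zero] at key
  rcases key with key | key
  · exact hδ key
  · have : (0 : ℝ) < r := by exact_mod_cast hr
    simp at key
    exact hr.ne' key

/-- Telescoping: on (0, n] the difference is at most the integral of q over (0, t]. The truncation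
at n is needed because q itself may have infinite integral. -/
theorem setLIntegral_sub_shift_le {q : ℝ → ℝ≥0∞} (hq : Antitone q) {c : ℝ≥0∞} (hc : c ≠ ∞)
    (hqc : ∀ s, q s ≤ c) (t : ℝ) (ht : 0 ≤ t) :
    ∫⁻ s in Ioi (0 : ℝ), (q s - q (s + t)) ≤ c * ENNReal.ofReal t := by
  have hm : Measurable fun s => q (s + t) := hq.measurable.comp (measurable_add_const t)
  have key : ∀ n : ℕ, ∫⁻ s in Ioc (0 : ℝ) n, (q s - q (s + t)) ≤ c * ENNReal.ofReal t := by
    intro n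
    have hfin : ∫⁻ s in Ioc (0 : ℝ) n, q (s + t) ≠ ∞ := by
      refine ((lintegral_mono fun s => hqc (s + t)).trans_lt ?_).ne
      rw [setLIntegral_const, Real.volume_Ioc]
      exact ENNReal.mul_lt_top hc.lt_top ENNReal.ofReal_lt_top
    have hshift : ∫⁻ s in Ioc (0 : ℝ) n, q (s + t) = ∫⁻ s in Ioc t (n + t), q s := by
      have hmp : MeasurePreserving (fun s : ℝ => s + t) volume volume :=
        measurePreserving_add_right volume t
      have := hmp.setLIntegral_comp_preimage (s := Ioc t (n + t)) measurableSet_Ioc hq.measurable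
      rw [← this]
      congr 2
      ext s
      simp
    rw [lintegral_sub hm hfin (ae_of_all _ fun s => hq (by linarith))]
    refine tsub_le_iff_right.2 ?_
    rw [hshift]
    calc ∫⁻ s in Ioc (0 : ℝ) n, q s ≤ ∫⁻ s in Ioc 0 t ∪ Ioc t (n + t), q s :=
          lintegral_mono_set fun s hs => by
            rcases le_or_gt s t with h | h
            · exact Or.inl ⟨hs.1, h⟩
            · exact Or.inr ⟨h, by linarith [hs.2]⟩
      _ ≤ (∫⁻ s in Ioc 0 t, q s) + ∫⁻ s in Ioc t (n + t), q s := lintegral_union_le _ _ _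
      _ ≤ c * ENNReal.ofReal t + ∫⁻ s in Ioc t (n + t), q s := by
          gcongr
          refine (lintegral_mono fun s => hqc s).trans_eq ?_
          rw [setLIntegral_const, Real.volume_Ioc, sub_zero]
  have hU : Ioi (0 : ℝ) = ⋃ n : ℕ, Ioc (0 : ℝ) n := by
    ext s
    simp only [mem_Ioi, mem_iUnion, mem_Ioc]
    exact ⟨fun h => (exists_nat_ge s).imp fun n hn => ⟨h, hn⟩, fun ⟨_, h, _⟩ => h⟩
  rw [hU, setLIntegral_iUnion_of_directed]
  · exact iSup_le key
  · exact directed_of_isDirected_le fun m n hmn => Ioc_subset_Ioc_right (by exact_mod_cast hmn)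

theorem lintegral_le_add_mul_measure {μ : Measure E} [IsProbabilityMeasure μ] {f g : E → ℝ≥0∞}
    (hg : AEMeasurable g μ) {N : Set E} (hN : NullMeasurableSet N μ) {c : ℝ≥0∞}
    (h : ∀ y, f y ≤ g y + c * N.indicator 1 y) : ∫⁻ y, f y ∂μ ≤ ∫⁻ y, g y ∂μ + c * μ N := by
  refine (lintegral_mono h).trans_eq ?_
  have hi : AEMeasurable (N.indicator (1 : E → ℝ≥0∞)) μ := aemeasurable_one.indicator₀ hN
  rw [lintegral_add_left' hg, lintegral_const_mul'' _ hi, lintegral_indicator_one₀ hN]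

/-! ### Bounded supermedian functions -/

namespace IsMarkovSemigroup

variable (hQ : IsMarkovSemigroup Q)
include hQ

theorem antitone_of_supermedian {g : E → ℝ≥0∞} (hg : Measurable g)
    (hsup : ∀ s x, 0 < s → ∫⁻ z, g z ∂(Q s x) ≤ g x) (x : E) {s t : ℝ≥0} (hs : 0 < s)
    (hst : s ≤ t) : ∫⁻ z, g z ∂(Q t x) ≤ ∫⁻ z, g z ∂(Q s x) := by
  rcases hst.eq_or_lt with rfl | hlt
  · exact le_rfl
  · have hpos : 0 < t - s := tsub_pos_of_lt hlt
    rw [← add_tsub_cancel_of_le hst, ← hQ.comp s (t - s) x hs hpos g hg]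
    exact lintegral_mono fun y => hsup _ y hpos

/-- The operators yield only universally measurable functions, so recurrence has to be applied to
sets that need not be Borel. -/
theorem isUniversallyMeasurable_drop {g : E → ℝ≥0∞} (hg : Measurable g) {t : ℝ≥0} (ht : 0 < t)
    (ε : ℝ≥0∞) : IsUniversallyMeasurable {y | ε < g y - ∫⁻ z, g z ∂(Q t y)} := fun μ hμ =>
  nullMeasurableSet_lt aemeasurable_const
    (hg.aemeasurable.sub (hQ.aemeasurable t ht g hg μ hμ))

/-- The potential of the set where a bounded supermedian function drops by more than `ε` in
time `t` is finite. -/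
theorem potential_drop_ne_top {g : E → ℝ≥0∞} (hg : Measurable g) {c : ℝ≥0∞} (hc : c ≠ ∞)
    (hgc : ∀ x, g x ≤ c) (hsup : ∀ s x, 0 < s → ∫⁻ z, g z ∂(Q s x) ≤ g x) {t : ℝ≥0} (ht : 0 < t)
    {ε : ℝ≥0∞} (hε : ε ≠ 0) (x : E) :
    potential Q x {y | ε < g y - ∫⁻ z, g z ∂(Q t y)} ≠ ∞ := by
  rcases eq_or_ne ε ∞ with rfl | hε'
  · simp [potential]
  have hQc : ∀ s x, 0 < s → ∫⁻ z, g z ∂(Q s x) ≤ c := fun s x hs => (hsup s x hs).trans (hgc x)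
  -- The value c at nonpositive times keeps q decreasing on the whole line without using the
  -- semigroup at time 0.
  set q : ℝ → ℝ≥0∞ := fun s => if 0 < s then ∫⁻ z, g z ∂(Q s.toNNReal x) else c with hq
  have hqa : Antitone q := by
    intro s s' hss
    by_cases h : 0 < s
    · simp only [hq, h, h.trans_le hss, if_true]
      exact hQ.antitone_of_supermedian hg hsup x (Real.toNNReal_pos.2 h)
        (Real.toNNReal_le_toNNReal hss)
    · simp only [hq, h, if_false]
      split_ifs with h'
      · exact hQc _ _ (Real.toNNReal_pos.2 h')
      · exact le_rfl
  have hqc : ∀ s, q s ≤ c := by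
    intro s
    simp only [hq]
    split_ifs with h'
    · exact hQc _ _ (Real.toNNReal_pos.2 h')
    · exact le_rfl
  have hbound := setLIntegral_sub_shift_le hqa hc hqc t t.2
  refine ((?_ : _ ≤ ε⁻¹ * (c * ENNReal.ofReal t)).trans_lt (ENNReal.mul_lt_top
    (ENNReal.inv_lt_top.2 hε.bot_lt) (ENNReal.mul_lt_top hc.lt_top ENNReal.ofReal_lt_top))).ne
  refine le_trans ?_ (mul_le_mul_right hbound _)
  rw [potential, setLIntegral_congr (Ioi_ae_eq_Ici (a := (0 : ℝ))).symm,
    ← lintegral_const_mul' _ _ (ENNReal.inv_ne_top.2 hε)]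
  refine setLIntegral_mono' measurableSet_Ioi fun s hs => ?_
  have hs0 : 0 < s.toNNReal := Real.toNNReal_pos.2 hs
  have := hQ.prob s.toNNReal x hs0
  have hA := hQ.aemeasurable t ht g hg _ this
  have e : q s - q (s + t) = ∫⁻ y, (g y - ∫⁻ z, g z ∂(Q t y)) ∂(Q s.toNNReal x) := by
    have h1 : 0 < s + t := add_pos_of_pos_of_nonneg hs t.2
    rw [lintegral_sub' hA, hQ.comp _ _ _ hs0 ht _ hg]
    · simp only [hq, mem_Ioi.1 hs, h1, if_true]
      rw [Real.toNNReal_add (mem_Ioi.1 hs).le t.coe_nonneg, Real.toNNReal_coe]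
    · rw [hQ.comp _ _ _ hs0 ht _ hg]
      exact ((hQc _ x (add_pos hs0 ht)).trans_lt hc.lt_top).ne
    · exact ae_of_all _ fun y => hsup t y ht
  rw [e, mul_comm, ← div_eq_mul_inv, ENNReal.le_div_iff_mul_le (Or.inl hε) (Or.inl hε'), mul_comm]
  -- Markov's inequality: ε Q_s(x, N) ≤ q(s) - q(s + t), where N is the drop set.
  refine le_trans ?_ (mul_meas_ge_le_lintegral₀ (hg.aemeasurable.sub hA) ε)
  gcongr
  exact fun h => le_of_lt h

/-- Bounded supermedian functions of a recurrent semigroup are invariant for strictly positive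
times. -/
theorem lintegral_eq_of_supermedian (hrec : IsRecurrent Q) {g : E → ℝ≥0∞} (hg : Measurable g)
    {c : ℝ≥0∞} (hc : c ≠ ∞) (hgc : ∀ x, g x ≤ c)
    (hsup : ∀ s x, 0 < s → ∫⁻ z, g z ∂(Q s x) ≤ g x) (x : E) {s t : ℝ≥0} (hs : 0 < s)
    (ht : 0 < t) : ∫⁻ z, g z ∂(Q s x) = ∫⁻ z, g z ∂(Q t x) := by
  wlog hst : s ≤ t generalizing s t
  · exact (this ht hs (le_of_not_ge hst)).symm
  refine le_antisymm ?_ (hQ.antitone_of_supermedian hg hsup x hs hst)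
  refine ENNReal.le_of_forall_pos_le_add fun ε hε _ => ?_
  set N := {y | (ε : ℝ≥0∞) < g y - ∫⁻ z, g z ∂(Q t y)} with hN
  have hNm := hQ.isUniversallyMeasurable_drop hg ht ε
  have hε0 : (ε : ℝ≥0∞) ≠ 0 := by exact_mod_cast hε.ne'
  have hpot : potential Q x N = 0 := by
    rcases hrec N hNm with h | h
    · exact h x
    · exact absurd (h x) (hQ.potential_drop_ne_top hg hc hgc hsup ht hε0 x)
  -- For r < s: Q_s g ≤ Q_r g ≤ Q_r Q_t g + ε + c Q_r(x, N) ≤ Q_t g + ε + c Q_r(x, N). The value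
  -- g(x) itself is out of reach, since x may lie in the drop set N.
  refine le_of_potential_eq_zero hpot hs hc fun r hr hrs => ?_
  have := hQ.prob r x hr
  have hA := hQ.aemeasurable t ht g hg _ this
  have hpt : ∀ y, g y ≤ (∫⁻ z, g z ∂(Q t y) + ε) + c * N.indicator 1 y := by
    intro y
    by_cases hy : y ∈ N
    · simpa [hy] using (hgc y).trans le_add_self
    · simp only [hy, not_false_eq_true, indicator_of_notMem, mul_zero, add_zero]
      exact tsub_le_iff_left.1 (not_lt.1 hy)
  have h1 := lintegral_le_add_mul_measure (hA.add_const _) (hNm _ this) hpt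
  rw [lintegral_add_right _ measurable_const, hQ.comp _ _ _ hr ht _ hg, lintegral_const,
    measure_univ, mul_one] at h1
  calc ∫⁻ z, g z ∂(Q s x) ≤ ∫⁻ z, g z ∂(Q r x) :=
        hQ.antitone_of_supermedian hg hsup x hr hrs.le
    _ ≤ _ := h1
    _ ≤ _ := add_le_add_left (add_le_add_left
        (hQ.antitone_of_supermedian hg hsup x ht le_add_self) _) _

end IsMarkovSemigroup

/-! ### Truncation, and constancy of exponentially decaying functions -/

theorem lintegral_iSup_min_natCast {μ : Measure E} {h : E → ℝ≥0∞} (hm : Measurable h)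
    (hfin : ∀ x, h x ≠ ∞) : ∫⁻ z, h z ∂μ = ⨆ n : ℕ, ∫⁻ z, min (h z) n ∂μ := by
  rw [← lintegral_iSup (fun n => hm.min measurable_const)
    (fun m n hmn z => min_le_min_left _ (by exact_mod_cast hmn))]
  refine lintegral_congr fun z => le_antisymm ?_ (iSup_le fun n => min_le_left _ _)
  obtain ⟨n, hn⟩ := ENNReal.exists_nat_gt (hfin z)
  exact le_iSup_of_le n (le_min le_rfl hn.le)

theorem IsMarkovSemigroup.lintegral_min_le (hQ : IsMarkovSemigroup Q) {h : E → ℝ≥0∞}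
    (hsup : ∀ s x, 0 < s → ∫⁻ z, h z ∂(Q s x) ≤ h x) (c : ℝ≥0∞) (s : ℝ≥0) (x : E) (hs : 0 < s) :
    ∫⁻ z, min (h z) c ∂(Q s x) ≤ min (h x) c := by
  have := hQ.prob s x hs
  refine le_min ((lintegral_mono fun z => min_le_left _ _).trans (hsup s x hs)) ?_
  exact (lintegral_mono fun z => min_le_right _ _).trans (by simp)

/-- A positive function which decays exponentially under a recurrent Markov semigroup is
constant. -/
theorem IsMarkovSemigroup.eq_of_isRecurrent (hQ : IsMarkovSemigroup Q) (hrec : IsRecurrent Q)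
    {h : E → ℝ≥0∞} (hm : Measurable h) (hpos : ∀ x, h x ≠ 0) (hfin : ∀ x, h x ≠ ∞)
    {a : ℝ} (ha : 0 ≤ a)
    (heig : ∀ s x, 0 < s → ∫⁻ z, h z ∂(Q s x) = ENNReal.ofReal (Real.exp (-a * s)) * h x) :
    ∃ d, ∀ x, h x = d := by
  rcases isEmpty_or_nonempty E with hE | ⟨⟨x₀⟩⟩
  · exact ⟨0, fun x => hE.elim x⟩
  have hsup : ∀ s x, 0 < s → ∫⁻ z, h z ∂(Q s x) ≤ h x := by
    intro s x hs
    rw [heig s x hs]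
    refine mul_le_of_le_one_left' (ENNReal.ofReal_le_one.2 (Real.exp_le_one_iff.2 ?_))
    exact mul_nonpos_of_nonpos_of_nonneg (neg_nonpos.2 ha) s.coe_nonneg
  have hinv : ∀ (c : ℝ≥0) (x : E) {s t : ℝ≥0}, 0 < s → 0 < t →
      ∫⁻ z, min (h z) c ∂(Q s x) = ∫⁻ z, min (h z) c ∂(Q t x) := fun c x s t hs ht =>
    hQ.lintegral_eq_of_supermedian hrec (hm.min measurable_const) ENNReal.coe_ne_top
      (fun x => min_le_right _ _) (fun s x hs => hQ.lintegral_min_le hsup c s x hs) x hs ht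
  obtain ⟨D, hDc, hDd⟩ := TopologicalSpace.exists_countable_dense ℝ≥0
  -- a point at which all truncations of `h` are invariant
  obtain ⟨y, hy⟩ : ∃ y, ∀ c ∈ D ∪ range ((↑) : ℕ → ℝ≥0),
      ∫⁻ z, min (h z) c ∂(Q 1 y) = min (h y) c := by
    have := hQ.prob 1 x₀ one_pos
    have hae : ∀ᵐ y ∂(Q 1 x₀), ∀ c ∈ D ∪ range ((↑) : ℕ → ℝ≥0),
        ∫⁻ z, min (h z) c ∂(Q 1 y) = min (h y) c := by
      refine (ae_ball_iff (hDc.union (countable_range _))).2 fun c _ => ?_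
      have hcm : Measurable fun z => min (h z) (c : ℝ≥0∞) := hm.min measurable_const
      refine ae_eq_of_ae_le_of_lintegral_le
        (ae_of_all _ fun y => hQ.lintegral_min_le hsup c 1 y one_pos) ?_ hcm.aemeasurable ?_
      · rw [hQ.comp 1 1 x₀ one_pos one_pos _ hcm]
        exact ((hQ.lintegral_min_le hsup c _ x₀ (by norm_num)).trans_lt
          ((min_le_right _ _).trans_lt ENNReal.coe_lt_top)).ne
      · rw [hQ.comp 1 1 x₀ one_pos one_pos _ hcm]
        exact (hinv c x₀ one_pos (by norm_num)).le
    exact hae.exists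
  have hy1 : ∫⁻ z, h z ∂(Q 1 y) = h y := by
    rw [lintegral_iSup_min_natCast hm hfin]
    have : ∀ n : ℕ, ∫⁻ z, min (h z) n ∂(Q 1 y) = min (h y) n := fun n => by
      simpa using hy n (Or.inr ⟨n, rfl⟩)
    simp_rw [this]
    refine le_antisymm (iSup_le fun n => min_le_left _ _) ?_
    obtain ⟨n, hn⟩ := ENNReal.exists_nat_gt (hfin y)
    exact le_iSup_of_le n (le_min le_rfl hn.le)
  -- At y, h = Q_1 h = exp(-a) h with h positive and finite.
  have ha0 : a = 0 := by
    have h1 := heig 1 y one_pos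
    rw [hy1] at h1
    have h2 : ENNReal.ofReal (Real.exp (-a * (1 : ℝ≥0))) = 1 :=
      (ENNReal.mul_eq_right (hpos y) (hfin y)).1 h1.symm
    have h3 : Real.exp (-a * (1 : ℝ≥0)) = 1 := by simpa using h2
    rw [Real.exp_eq_one_iff] at h3
    simpa using h3
  subst ha0
  have heig' : ∀ s x, 0 < s → ∫⁻ z, h z ∂(Q s x) = h x := fun s x hs => by
    simpa using heig s x hs
  have hconst : ∀ s, 0 < s → h =ᵐ[Q s y] fun _ => h y := by
    intro s hs
    have := hQ.prob s y hs
    -- For c ≤ h(y) the mean of min(h, c) equals its upper bound c, so h ≥ c almost surely. Letting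
    -- c increase to h(y) gives h ≥ h(y), and the mean of h is h(y), so equality holds almost
    -- surely.
    have hge : ∀ᵐ z ∂(Q s y), ∀ c ∈ D, (c : ℝ≥0∞) ≤ h y → (c : ℝ≥0∞) ≤ h z := by
      refine (ae_ball_iff hDc).2 fun c hc => ?_
      by_cases hcy : (c : ℝ≥0∞) ≤ h y
      · have e : (fun z => min (h z) (c : ℝ≥0∞)) =ᵐ[Q s y] fun _ => (c : ℝ≥0∞) := by
          refine ae_eq_of_ae_le_of_lintegral_le (ae_of_all _ fun z => min_le_right _ _)
            ?_ aemeasurable_const ?_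
          · exact ((hQ.lintegral_min_le hsup c s y hs).trans_lt
              ((min_le_right _ _).trans_lt ENNReal.coe_lt_top)).ne
          · rw [hinv c y hs one_pos, hy c (Or.inl hc), min_eq_right hcy]
            simp
        filter_upwards [e] with z hz _
        exact min_eq_right_iff.1 hz
      · exact ae_of_all _ fun z hz => absurd hz hcy
    have hge' : (fun _ => h y) ≤ᵐ[Q s y] h := by
      filter_upwards [hge] with z hz
      refine le_of_forall_lt fun b hb => ?_
      lift b to ℝ≥0 using (hb.trans_le le_top).ne
      lift h y to ℝ≥0 using hfin y with d
      obtain ⟨c, hcD, hc⟩ := hDd.exists_between (ENNReal.coe_lt_coe.1 hb)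
      exact (ENNReal.coe_lt_coe.2 hc.1).trans_le (hz c hcD (ENNReal.coe_le_coe.2 hc.2.le))
    refine (ae_eq_of_ae_le_of_lintegral_le hge' ?_ hm.aemeasurable ?_).symm
    · simpa using hfin y
    · rw [heig' s y hs]
      simp
  set N : Set E := {z | h z ≠ h y} with hN
  have hNm : MeasurableSet N := (hm (measurableSet_singleton (h y))).compl
  have hNy : potential Q y N = 0 := by
    rw [potential, setLIntegral_congr (Ioi_ae_eq_Ici (a := (0 : ℝ))).symm]
    refine (setLIntegral_congr_fun measurableSet_Ioi (g := fun _ => 0) fun s hs => ?_).trans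
      (by simp)
    exact ae_iff.1 (hconst _ (Real.toNNReal_pos.2 hs))
  have hN0 : ∀ x, potential Q x N = 0 := by
    rcases hrec N (fun μ _ => hNm.nullMeasurableSet) with H | H
    · exact H
    · simp [H y] at hNy
  -- Replace time 1 by a small time s. Off N the truncations of h and h(y) agree, so the two sides
  -- differ by at most c Q_s(x, N), and N has zero potential at x.
  have hmin : ∀ (c : ℝ≥0) x, ∫⁻ z, min (h z) c ∂(Q 1 x) = min (h y) c := by
    intro c x
    have hcm : Measurable fun z => min (h z) (c : ℝ≥0∞) := hm.min measurable_const
    refine le_antisymm ?_ ?_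
    · refine le_of_potential_eq_zero (hN0 x) one_pos (c := c) ENNReal.coe_ne_top fun s hs _ => ?_
      have := hQ.prob s x hs
      rw [hinv c x one_pos hs]
      refine (lintegral_le_add_mul_measure (g := fun _ => min (h y) (c : ℝ≥0∞))
        aemeasurable_const hNm.nullMeasurableSet (c := c) fun z => ?_).trans_eq (by simp)
      by_cases hz : z ∈ N
      · simp [hz]
      · simp [hz, not_not.1 hz]
    · refine le_of_potential_eq_zero (hN0 x) one_pos (c := c) ENNReal.coe_ne_top fun s hs _ => ?_
      have := hQ.prob s x hs
      rw [hinv c x one_pos hs]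
      have h1 := lintegral_le_add_mul_measure (μ := Q s x) (f := fun _ => min (h y) (c : ℝ≥0∞))
        hcm.aemeasurable hNm.nullMeasurableSet (c := c) fun z => ?_
      · simpa using h1
      · by_cases hz : z ∈ N
        · simp [hz]
        · simp [hz, not_not.1 hz]
  refine ⟨h y, fun x => ?_⟩
  rw [← heig' 1 x one_pos, ← hy1, lintegral_iSup_min_natCast hm hfin,
    lintegral_iSup_min_natCast hm hfin]
  refine iSup_congr fun n => ?_
  have h1 := hmin n x
  have h2 := hmin n y
  simp only [ENNReal.coe_natCast] at h1 h2
  rw [h1, h2]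

end Recurrent

/-! ### The Markov property -/

/-- A function measurable up to null sets has a measurable version. -/
theorem exists_measurable_ae_eq_of_eventuallyMeasurable {Ω : Type*} {m m₀ : MeasurableSpace Ω}
    {μ : Measure Ω} {f : Ω → ℝ≥0∞}
    (hf : Measurable[eventuallyMeasurableSpace m (ae μ)] f) :
    ∃ g, Measurable[m] g ∧ f =ᵐ[μ] g := by
  refine @Measurable.ennreal_induction Ω (eventuallyMeasurableSpace m (ae μ))
    (fun f => ∃ g, Measurable[m] g ∧ f =ᵐ[μ] g) ?_ ?_ ?_ f hf
  · intro c s hs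
    obtain ⟨t, ht, hst⟩ := hs
    refine ⟨t.indicator fun _ => c, measurable_const.indicator ht, ?_⟩
    exact indicator_ae_eq_of_ae_eq_set hst
  · intro f g _ _ _ ihf ihg
    obtain ⟨f', hf', hff⟩ := ihf
    obtain ⟨g', hg', hgg⟩ := ihg
    exact ⟨f' + g', hf'.add hg', hff.add hgg⟩
  · intro f _ _ ih
    choose f' hf' hff using ih
    refine ⟨fun ω => ⨆ n, f' n ω, Measurable.iSup hf', ?_⟩
    filter_upwards [ae_all_iff.2 hff] with ω hω
    simp [hω]

/-- Measures which agree on a sub-σ-algebra give the same integrals to functions measurable with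
respect to it. -/
theorem lintegral_mul_eq_of_forall_setLIntegral_eq {Ω : Type*} {m m₀ : MeasurableSpace Ω}
    (hm : m ≤ m₀) {μ : Measure Ω} {f g W : Ω → ℝ≥0∞} (hf : Measurable f) (hg : Measurable g)
    (hW : Measurable[m] W)
    (h : ∀ A, MeasurableSet[m] A → ∫⁻ ω in A, f ω ∂μ = ∫⁻ ω in A, g ω ∂μ) :
    ∫⁻ ω, W ω * f ω ∂μ = ∫⁻ ω, W ω * g ω ∂μ := by
  have e : (μ.withDensity f).trim hm = (μ.withDensity g).trim hm := by
    refine @Measure.ext _ m _ _ fun A hA => ?_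
    rw [trim_measurableSet_eq hm hA, trim_measurableSet_eq hm hA, withDensity_apply _ (hm _ hA),
      withDensity_apply _ (hm _ hA), h A hA]
  have hWm : Measurable W := hW.mono hm le_rfl
  have e1 := lintegral_withDensity_eq_lintegral_mul μ hf hWm
  have e2 := lintegral_withDensity_eq_lintegral_mul μ hg hWm
  simp only [Pi.mul_apply, mul_comm (f _), mul_comm (g _)] at e1 e2
  rw [← e1, ← e2, ← lintegral_trim hm hW, ← lintegral_trim hm hW, e]

namespace BorelRightProcess

variable {Ω : Type u} {E : Type v} [mΩ : MeasurableSpace Ω] [TopologicalSpace E]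
  [mE : MeasurableSpace E] (Y : BorelRightProcess Ω E)

theorem isProbabilityMeasure (x : E) : IsProbabilityMeasure (Y.P x) :=
  Y.isMarkovKernel.isProbabilityMeasure x

theorem measurable_theta (t : ℝ≥0) : Measurable (Y.θ t) := by
  have h : ∀ s, Measurable[⨆ t, mE.comap (Y.X t)] (Y.X s) := fun s =>
    (comap_measurable (Y.X s)).mono (le_iSup (fun t => mE.comap (Y.X t)) s) le_rfl
  have key : @Measurable _ _ mΩ (⨆ t, mE.comap (Y.X t)) (Y.θ t) := by
    rw [measurable_iff_comap_le, MeasurableSpace.comap_iSup]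
    refine iSup_le fun s => ?_
    rw [MeasurableSpace.comap_comp, ← measurable_iff_comap_le]
    have : Y.X s ∘ Y.θ t = Y.X (s + t) := funext fun ω => Y.X_shift s t ω
    rw [this]
    exact Y.measurable_X _
  rwa [← Y.generated] at key

theorem measurable_X_filtration {s t : ℝ≥0} (h : s ≤ t) : Measurable[Y.filtration t] (Y.X s) :=
  (comap_measurable (Y.X s)).mono (le_iSup₂ (f := fun s (_ : s ≤ t) => mE.comap (Y.X s)) s h)
    le_rfl

/-- This is the strong Markov property at a constant time, started from a Dirac mass and restricted
to events of the smaller σ-algebra 𝓕⁰_t ⊆ 𝓕⁰_{t+}. -/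
theorem setLIntegral_transition (x : E) (t s : ℝ≥0) {A : Set Ω}
    (hA : MeasurableSet[Y.filtration t] A) {B : Set E} (hB : MeasurableSet B) :
    ∫⁻ ω in A, Y.P (Y.X t ω) {ω' | Y.X s ω' ∈ B} ∂(Y.P x) =
      Y.P x (A ∩ {ω | Y.X (t + s) ω ∈ B}) := by
  have := Y.isProbabilityMeasure
  have hst := isStoppingTime_const (naturalFiltration Y.X Y.measurable_X).rightCont t
  have hmk := Y.strongMarkov (fun _ => (t : WithTop ℝ≥0)) hst (Measure.dirac x) inferInstance s B hB
  rw [Measure.dirac_bind Y.P.measurable] at hmk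
  have hle : Y.filtration t ≤ hst.measurableSpace := by
    rw [IsStoppingTime.measurableSpace_const]
    exact Filtration.le_rightCont _ t
  have hset : MeasurableSet {ω | Y.X (t + s) ω ∈ B} := Y.measurable_X _ hB
  have hXs : MeasurableSet {ω | Y.X s ω ∈ B} := Y.measurable_X _ hB
  have hA' : MeasurableSet A := Y.filtration.le t A hA
  have huniv : {ω : Ω | ((t : WithTop ℝ≥0)) < ⊤} = univ :=
    eq_univ_of_forall fun _ => WithTop.coe_lt_top t
  rw [huniv, Measure.restrict_univ] at hmk
  simp only [WithTop.untopD_coe] at hmk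
  have h1 := setIntegral_condExp (μ := Y.P x) (hst.measurableSpace_le)
    (f := {ω | Y.X (t + s) ω ∈ B}.indicator fun _ => (1 : ℝ))
    ((integrable_const _).indicator hset) (hle A hA)
  rw [setIntegral_congr_ae hA' (hmk.mono fun ω h _ => h), setIntegral_indicator hset,
    setIntegral_const, smul_eq_mul, mul_one] at h1
  have h2 := congrArg ENNReal.ofReal h1
  rw [ofReal_measureReal, ofReal_integral_eq_lintegral_ofReal] at h2
  · simpa using h2
  · refine Integrable.of_bound (C := 1) ?_ ?_
    · exact (((Y.P.measurable_coe hXs).ennreal_toReal).comp (Y.measurable_X t)).aestronglyMeasurable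
    · exact ae_of_all _ fun ω => by
        rw [Real.norm_of_nonneg measureReal_nonneg]; exact measureReal_le_one
  · exact ae_of_all _ fun ω => measureReal_nonneg

theorem setLIntegral_transition_fun (x : E) (t s : ℝ≥0) {A : Set Ω}
    (hA : MeasurableSet[Y.filtration t] A) {f : E → ℝ≥0∞} (hf : Measurable f) :
    ∫⁻ ω in A, ∫⁻ ω', f (Y.X s ω') ∂(Y.P (Y.X t ω)) ∂(Y.P x) =
      ∫⁻ ω in A, f (Y.X (t + s) ω) ∂(Y.P x) := by
  have := Y.isProbabilityMeasure
  have hbm : Measurable fun y => (Y.P y).map (Y.X s) :=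
    (Measure.measurable_map _ (Y.measurable_X s)).comp Y.P.measurable
  have e : (((Y.P x).restrict A).map (Y.X t)).bind (fun y => (Y.P y).map (Y.X s)) =
      ((Y.P x).restrict A).map (Y.X (t + s)) := by
    ext B hB
    rw [Measure.bind_apply hB hbm.aemeasurable,
      lintegral_map (f := fun y => (Y.P y).map (Y.X s) B)
        ((Measure.measurable_coe hB).comp hbm) (Y.measurable_X t),
      Measure.map_apply (Y.measurable_X _) hB,
      Measure.restrict_apply (Y.measurable_X _ hB), inter_comm]
    simp_rw [Measure.map_apply (Y.measurable_X s) hB]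
    exact Y.setLIntegral_transition x t s hA hB
  rw [← lintegral_map hf (Y.measurable_X (t + s)), ← e,
    Measure.lintegral_bind hbm.aemeasurable hf.aemeasurable,
    lintegral_map (f := fun y => ∫⁻ z, f z ∂((Y.P y).map (Y.X s)))
      ((Measure.measurable_lintegral hf).comp hbm) (Y.measurable_X t)]
  simp_rw [lintegral_map hf (Y.measurable_X s)]

/-- The Markov property for cylinder sets. -/
theorem setLIntegral_cylinder (B : ℝ≥0 → Set E) (I : Finset ℝ≥0)
    -- The base time w, from which the times in I are counted, is quantified so that the induction
    -- can restart at the smallest index.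
    (hB : ∀ i ∈ I, MeasurableSet (B i)) : ∀ (w t : ℝ≥0) (x : E) (A : Set Ω), (∀ i ∈ I, w ≤ i) →
      MeasurableSet[Y.filtration t] A →
      ∫⁻ ω in A, Y.P (Y.X t ω) (⋂ i ∈ I, {ω' | Y.X (i - w) ω' ∈ B i}) ∂(Y.P x) =
        Y.P x (A ∩ ⋂ i ∈ I, {ω | Y.X (t + (i - w)) ω ∈ B i}) := by
  have := Y.isProbabilityMeasure
  induction I using Finset.induction_on_min with
  | empty => intro w t x A _ hA; simp
  | insert a I hlt ih =>
    intro w t x A hw hA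
    have hBa := hB a (Finset.mem_insert_self a I)
    have hBI : ∀ i ∈ I, MeasurableSet (B i) := fun i hi => hB i (Finset.mem_insert_of_mem hi)
    have hwa : w ≤ a := hw a (Finset.mem_insert_self a I)
    have haI : ∀ i ∈ I, a ≤ i := fun i hi => (hlt i hi).le
    have hadd : ∀ i ∈ I, a - w + (i - a) = i - w := fun i hi => by
      rw [add_comm, tsub_add_tsub_cancel (haI i hi) hwa]
    have hC : MeasurableSet (⋂ i ∈ I, {ω' | Y.X (i - a) ω' ∈ B i}) :=
      Finset.measurableSet_biInter _ fun i hi => Y.measurable_X _ (hBI i hi)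
    set φ : E → ℝ≥0∞ := fun y => Y.P y (⋂ i ∈ I, {ω' | Y.X (i - a) ω' ∈ B i}) with hφ
    have hφm : Measurable φ := Y.P.measurable_coe hC
    -- Used twice: at r = t under P_x, and at r = 0 under the law started from X_t. The one-time
    -- Markov property joins the two.
    have step : ∀ (r : ℝ≥0) (y : E) (A' : Set Ω), MeasurableSet[Y.filtration r] A' →
        Y.P y (A' ∩ ⋂ i ∈ insert a I, {ω | Y.X (r + (i - w)) ω ∈ B i}) =
          ∫⁻ ω in A', (B a).indicator φ (Y.X (r + (a - w)) ω) ∂(Y.P y) := by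
      intro r y A' hA'
      have hXa : MeasurableSet[Y.filtration (r + (a - w))] {ω | Y.X (r + (a - w)) ω ∈ B a} :=
        Y.measurable_X_filtration le_rfl hBa
      have h := ih hBI a (r + (a - w)) y (A' ∩ {ω | Y.X (r + (a - w)) ω ∈ B a}) haI
        ((Y.filtration.mono le_self_add _ hA').inter hXa)
      have e : (⋂ i ∈ I, {ω | Y.X (r + (a - w) + (i - a)) ω ∈ B i}) =
          ⋂ i ∈ I, {ω | Y.X (r + (i - w)) ω ∈ B i} :=
        iInter₂_congr fun i hi => by rw [add_assoc, hadd i hi]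
      rw [e, inter_assoc] at h
      rw [Finset.set_biInter_insert, ← h, inter_comm, ← setLIntegral_indicator (Y.filtration.le _ _ hXa)]
      rfl
    rw [← Y.setLIntegral_transition_fun x t (a - w) hA (hφm.indicator hBa) |>.trans
      (step t x A hA).symm]
    refine lintegral_congr fun ω => ?_
    have h := step 0 (Y.X t ω) univ MeasurableSet.univ
    simpa using h

/-- The Markov property. -/
theorem setLIntegral_theta (x : E) (t : ℝ≥0) {A : Set Ω} (hA : MeasurableSet[Y.filtration t] A)
    {Z : Ω → ℝ≥0∞} (hZ : Measurable Z) :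
    ∫⁻ ω in A, Z (Y.θ t ω) ∂(Y.P x) =
      ∫⁻ ω in A, ∫⁻ ω', Z ω' ∂(Y.P (Y.X t ω)) ∂(Y.P x) := by
  have := Y.isProbabilityMeasure
  -- Both sides are finite measures of equal mass on Ω, so agreement on the generating π-system of
  -- cylinders suffices.
  have e : (((Y.P x).restrict A).map (Y.X t)).bind Y.P = ((Y.P x).restrict A).map (Y.θ t) := by
    have hgen : mΩ = MeasurableSpace.generateFrom
        (piiUnionInter (fun i => {s | MeasurableSet[mE.comap (Y.X i)] s}) univ) := by
      rw [generateFrom_piiUnionInter_measurableSet (fun i => mE.comap (Y.X i))]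
      simpa using Y.generated
    have hA' : MeasurableSet A := Y.filtration.le t A hA
    have huniv : (((Y.P x).restrict A).map (Y.X t)).bind Y.P univ =
        ((Y.P x).restrict A).map (Y.θ t) univ := by
      simp [Measure.bind_apply MeasurableSet.univ Y.P.measurable.aemeasurable,
        Measure.map_apply (Y.measurable_X t), Measure.map_apply (Y.measurable_theta t)]
    have hfin : IsFiniteMeasure (((Y.P x).restrict A).map (Y.θ t)) := inferInstance
    have hfin' : IsFiniteMeasure ((((Y.P x).restrict A).map (Y.X t)).bind Y.P) :=
      ⟨huniv ▸ measure_lt_top _ _⟩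
    refine ext_of_generate_finite _ hgen (isPiSystem_piiUnionInter _
      (fun i => @MeasurableSpace.isPiSystem_measurableSet _ (mE.comap (Y.X i))) _) ?_ huniv
    rintro _ ⟨I, _, f, hf, rfl⟩
    choose! B hB hBf using hf
    have hcyl : (⋂ i ∈ I, f i) = ⋂ i ∈ I, {ω | Y.X i ω ∈ B i} :=
      iInter₂_congr fun i hi => (hBf i hi).symm
    have hm : MeasurableSet (⋂ i ∈ I, {ω | Y.X i ω ∈ B i}) :=
      Finset.measurableSet_biInter _ fun i hi => Y.measurable_X _ (hB i hi)
    have key := Y.setLIntegral_cylinder B I hB 0 t x A (fun i _ => zero_le) hA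
    simp only [tsub_zero] at key
    rw [hcyl, Measure.bind_apply hm Y.P.measurable.aemeasurable,
      lintegral_map (Y.P.measurable_coe hm) (Y.measurable_X t), key,
      Measure.map_apply (Y.measurable_theta t) hm,
      Measure.restrict_apply (Y.measurable_theta t hm), inter_comm]
    congr 2
    ext ω
    simp [Y.X_shift, add_comm]
  rw [← lintegral_map hZ (Y.measurable_theta t), ← e,
    Measure.lintegral_bind Y.P.measurable.aemeasurable hZ.aemeasurable,
    lintegral_map hZ.lintegral_kernel (Y.measurable_X t)]

end BorelRightProcess

/-! ### The eigen-measure semigroup -/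

namespace BorelRightProcess

variable {Ω : Type u} {E : Type v} [mΩ : MeasurableSpace Ω] [TopologicalSpace E]
  [mE : MeasurableSpace E] (Y : BorelRightProcess Ω E) {S : ℝ≥0 → Ω → ℝ}

/-- The pricing operators on `[0, ∞]`-valued functions. -/
def lpricing (S : ℝ≥0 → Ω → ℝ) (t : ℝ≥0) (F : E → ℝ≥0∞) (x : E) : ℝ≥0∞ :=
  ∫⁻ ω, ENNReal.ofReal (S t ω) * F (Y.X t ω) ∂(Y.P x)

variable {Y}

namespace IsPricingKernel

variable (hS : Y.IsPricingKernel S)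
include hS

/-- S_t is measurable only for the augmented σ-algebra, so a 𝓕⁰_t-measurable version is chosen
separately for each initial law. -/
theorem exists_measurable_version (t : ℝ≥0) (μ : Measure E) [hμ : IsProbabilityMeasure μ] :
    ∃ W : Ω → ℝ≥0∞, Measurable[Y.filtration t] W ∧
      (fun ω => ENNReal.ofReal (S t ω)) =ᵐ[μ.bind Y.P] W := by
  have h1 : Measurable[(completedFiltration Y.filtration (μ.bind Y.P)).seq t] (S t) :=
    (hS.adapted t).mono (iInf₂_le μ hμ) le_rfl
  exact exists_measurable_ae_eq_of_eventuallyMeasurable (m := Y.filtration t)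
    (ENNReal.measurable_ofReal.comp h1)

theorem exists_measurable_version_apply (t : ℝ≥0) (x : E) :
    ∃ W : Ω → ℝ≥0∞, Measurable[Y.filtration t] W ∧
      (fun ω => ENNReal.ofReal (S t ω)) =ᵐ[Y.P x] W := by
  have := hS.exists_measurable_version t (Measure.dirac x)
  rwa [Measure.dirac_bind Y.P.measurable] at this

theorem aemeasurable_lpricing (t : ℝ≥0) {F : E → ℝ≥0∞} (hF : Measurable F) (μ : Measure E)
    [IsProbabilityMeasure μ] : AEMeasurable (Y.lpricing S t F) μ := by
  have := Y.isMarkovKernel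
  obtain ⟨W, hW, hSW⟩ := hS.exists_measurable_version t μ
  have hWm : Measurable W := hW.mono (Y.filtration.le t) le_rfl
  refine ⟨fun y => ∫⁻ ω, W ω * F (Y.X t ω) ∂(Y.P y),
    (hWm.mul (hF.comp (Y.measurable_X t))).lintegral_kernel, ?_⟩
  filter_upwards [Measure.ae_ae_of_ae_bind Y.P.measurable.aemeasurable hSW] with y hy
  refine lintegral_congr_ae ?_
  filter_upwards [hy] with ω hω
  rw [hω]

/-- Since S_{s+t} = S_s · (S_t ∘ θ_s), condition at time s. The version W of S_t is taken for the
law of X_s under P_x: the shift θ_s carries P_x to the process law with that initial law, so W ∘ θ_s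
is a version of S_t ∘ θ_s under P_x. -/
theorem lpricing_lpricing (s t : ℝ≥0) {F : E → ℝ≥0∞} (hF : Measurable F) (x : E) :
    Y.lpricing S s (Y.lpricing S t F) x = Y.lpricing S (s + t) F x := by
  have := Y.isMarkovKernel
  have hμ : IsProbabilityMeasure ((Y.P x).map (Y.X s)) :=
    Measure.isProbabilityMeasure_map (Y.measurable_X s).aemeasurable
  obtain ⟨V, hV, hSV⟩ := hS.exists_measurable_version_apply s x
  obtain ⟨W, hW, hSW⟩ := hS.exists_measurable_version t ((Y.P x).map (Y.X s))
  have hWm : Measurable W := hW.mono (Y.filtration.le t) le_rfl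
  set Z : Ω → ℝ≥0∞ := fun ω => W ω * F (Y.X t ω) with hZ
  have hZm : Measurable Z := hWm.mul (hF.comp (Y.measurable_X t))
  have hlaw : ((Y.P x).map (Y.X s)).bind Y.P = (Y.P x).map (Y.θ s) := by
    ext C hC
    have h := Y.setLIntegral_theta x s (A := univ) MeasurableSet.univ
      (Z := C.indicator 1) (measurable_one.indicator hC)
    rw [Measure.restrict_univ] at h
    rw [Measure.bind_apply hC Y.P.measurable.aemeasurable,
      lintegral_map (Y.P.measurable_coe hC) (Y.measurable_X s), ← lintegral_indicator_one hC,
      lintegral_map (measurable_one.indicator hC) (Y.measurable_theta s), h]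
    simp_rw [lintegral_indicator_one hC]
  have hZθ : ∀ᵐ ω ∂(Y.P x), ENNReal.ofReal (S t (Y.θ s ω)) = W (Y.θ s ω) := by
    have h := hSW
    rw [hlaw] at h
    exact ae_of_ae_map (Y.measurable_theta s).aemeasurable h
  have hT : ∀ᵐ ω ∂(Y.P x), Y.lpricing S t F (Y.X s ω) = ∫⁻ ω', Z ω' ∂(Y.P (Y.X s ω)) := by
    have h := Measure.ae_ae_of_ae_bind Y.P.measurable.aemeasurable hSW
    filter_upwards [ae_of_ae_map (Y.measurable_X s).aemeasurable h] with ω hω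
    refine lintegral_congr_ae ?_
    filter_upwards [hω] with ω' hω'
    rw [hω']
  calc Y.lpricing S s (Y.lpricing S t F) x
      = ∫⁻ ω, V ω * ∫⁻ ω', Z ω' ∂(Y.P (Y.X s ω)) ∂(Y.P x) := by
        refine lintegral_congr_ae ?_
        filter_upwards [hSV, hT] with ω h1 h2
        rw [h1, h2]
    _ = ∫⁻ ω, V ω * Z (Y.θ s ω) ∂(Y.P x) := by
        refine (lintegral_mul_eq_of_forall_setLIntegral_eq (Y.filtration.le s)
          (hZm.comp (Y.measurable_theta s)) (hZm.lintegral_kernel.comp (Y.measurable_X s)) hV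
          fun A hA => Y.setLIntegral_theta x s hA hZm).symm
    _ = Y.lpricing S (s + t) F x := by
        refine lintegral_congr_ae ?_
        filter_upwards [hSV, hZθ, hS.multiplicative t s x, hS.pos x] with ω h1 h2 h3 h4
        rw [h3, ENNReal.ofReal_mul (h4 s).le, h2, ← h1, mul_assoc, add_comm s t,
          ← Y.X_shift t s ω]

theorem lpricing_ofReal {lam : ℝ} {π : E → ℝ} (hπ : Y.IsPositiveEigenfunction S lam π) {t : ℝ≥0}
    (ht : 0 < t) (x : E) :
    Y.lpricing S t (fun y => ENNReal.ofReal (π y)) x =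
      ENNReal.ofReal (Real.exp (-lam * t) * π x) := by
  have hpos := hS.pos x
  rw [← hπ.eigen t x ht, pricing, ofReal_integral_eq_lintegral_ofReal (hπ.integrable t x ht)]
  · refine lintegral_congr_ae ?_
    filter_upwards [hpos] with ω hω
    rw [ENNReal.ofReal_mul (hω t).le]
  · filter_upwards [hpos] with ω hω
    exact mul_nonneg (hω t).le (hπ.pos _).le

/-- The transition function under the eigen-measure is the `π`-transform of the pricing
operators. -/
theorem lintegral_eigenTransition {lam : ℝ} {π : E → ℝ} (hπ : Y.IsPositiveEigenfunction S lam π)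
    (t : ℝ≥0) (x : E) {F : E → ℝ≥0∞} (hF : AEMeasurable F ((Y.P x).map (Y.X t))) :
    ∫⁻ z, F z ∂(Y.eigenTransition S lam π t x) =
      ENNReal.ofReal (Real.exp (lam * t) / π x) *
        Y.lpricing S t (fun y => ENNReal.ofReal (π y) * F y) x := by
  obtain ⟨W, hW, hSW⟩ := hS.exists_measurable_version_apply t x
  have hWm : Measurable W := hW.mono (Y.filtration.le t) le_rfl
  have hM : (fun ω => ENNReal.ofReal (Y.eigenMartingale S lam π t ω)) =ᵐ[Y.P x] fun ω =>
      ENNReal.ofReal (Real.exp (lam * t) / π x) *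
        (ENNReal.ofReal (S t ω) * ENNReal.ofReal (π (Y.X t ω))) := by
    filter_upwards [Y.normal x, hS.pos x] with ω h0 h1
    rw [eigenMartingale, h0, ← ENNReal.ofReal_mul (h1 t).le,
      ← ENNReal.ofReal_mul (div_nonneg (Real.exp_pos _).le (hπ.pos x).le)]
    congr 1
    ring
  have hMm : AEMeasurable (fun ω => ENNReal.ofReal (Y.eigenMartingale S lam π t ω)) (Y.P x) := by
    refine AEMeasurable.congr ?_ hM.symm
    exact ((AEMeasurable.congr hWm.aemeasurable hSW.symm).mul
      (hπ.measurable.ennreal_ofReal.comp (Y.measurable_X t)).aemeasurable).const_mul _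
  have hF' : AEMeasurable F (Y.eigenTransition S lam π t x) :=
    hF.mono_ac ((withDensity_absolutelyContinuous _ _).map (Y.measurable_X t))
  rw [eigenTransition, lintegral_map' hF' (Y.measurable_X t).aemeasurable, eigenMeasure,
    lintegral_withDensity_eq_lintegral_mul₀ (g := fun ω => F (Y.X t ω)) hMm
      (hF.comp_measurable (Y.measurable_X t)),
    lpricing, ← lintegral_const_mul' _ _ ENNReal.ofReal_ne_top]
  refine lintegral_congr_ae ?_
  filter_upwards [hM] with ω hω
  simp only [Pi.mul_apply]
  rw [hω]
  ring

/-- The factor π₁ of the Doob transform cancels the denominator, leaving the pricing operator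
applied to π₂. -/
theorem lintegral_eigenTransition_div {lam₁ lam₂ : ℝ} {π₁ π₂ : E → ℝ}
    (h₁ : Y.IsPositiveEigenfunction S lam₁ π₁) (h₂ : Y.IsPositiveEigenfunction S lam₂ π₂)
    {t : ℝ≥0} (ht : 0 < t) (x : E) :
    ∫⁻ z, ENNReal.ofReal (π₂ z / π₁ z) ∂(Y.eigenTransition S lam₁ π₁ t x) =
      ENNReal.ofReal (Real.exp (-(lam₂ - lam₁) * t)) * ENNReal.ofReal (π₂ x / π₁ x) := by
  have e : (fun y => ENNReal.ofReal (π₁ y) * ENNReal.ofReal (π₂ y / π₁ y)) =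
      fun y => ENNReal.ofReal (π₂ y) := by
    funext y
    rw [← ENNReal.ofReal_mul (h₁.pos y).le, mul_div_cancel₀ _ (h₁.pos y).ne']
  have hm : Measurable fun y => ENNReal.ofReal (π₂ y / π₁ y) :=
    (h₂.measurable.div h₁.measurable).ennreal_ofReal
  rw [hS.lintegral_eigenTransition h₁ t x hm.aemeasurable, e,
    hS.lpricing_ofReal h₂ ht,
    ← ENNReal.ofReal_mul (div_nonneg (Real.exp_pos _).le (h₁.pos x).le),
    ← ENNReal.ofReal_mul (Real.exp_pos _).le]
  congr 1
  have hexp : Real.exp (-(lam₂ - lam₁) * t) = Real.exp (lam₁ * t) * Real.exp (-lam₂ * t) := by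
    rw [← Real.exp_add]
    ring_nf
  rw [hexp]
  ring

theorem aemeasurable_lintegral_eigenTransition {lam : ℝ} {π : E → ℝ}
    (hπ : Y.IsPositiveEigenfunction S lam π) (s : ℝ≥0) {F : E → ℝ≥0∞} (hF : Measurable F)
    (μ : Measure E) [IsProbabilityMeasure μ] :
    AEMeasurable (fun y => ∫⁻ z, F z ∂(Y.eigenTransition S lam π s y)) μ := by
  simp_rw [hS.lintegral_eigenTransition hπ s _ hF.aemeasurable]
  exact ((measurable_const.div hπ.measurable).ennreal_ofReal.aemeasurable).mul
    (hS.aemeasurable_lpricing s (hπ.measurable.ennreal_ofReal.mul hF) μ)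

theorem isMarkovSemigroup {lam : ℝ} {π : E → ℝ} (hπ : Y.IsPositiveEigenfunction S lam π) :
    IsMarkovSemigroup (Y.eigenTransition S lam π) where
  prob s x hs := by
    -- Total mass one is the ratio identity with both eigenfunctions equal.
    have h := hS.lintegral_eigenTransition_div hπ hπ hs x
    simp only [div_self (hπ.pos _).ne', sub_self, neg_zero, zero_mul, Real.exp_zero,
      ENNReal.ofReal_one, lintegral_one, mul_one] at h
    exact ⟨h⟩
  aemeasurable s _ F hF μ _ := hS.aemeasurable_lintegral_eigenTransition hπ s hF μ
  comp s t x hs ht F hF := by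
    have := Y.isProbabilityMeasure x
    have hμ : IsProbabilityMeasure ((Y.P x).map (Y.X s)) :=
      Measure.isProbabilityMeasure_map (Y.measurable_X s).aemeasurable
    have hm : Measurable fun z => ENNReal.ofReal (π z) * F z :=
      hπ.measurable.ennreal_ofReal.mul hF
    have e : (fun y => ENNReal.ofReal (π y) * ∫⁻ z, F z ∂(Y.eigenTransition S lam π t y)) =
        fun y => ENNReal.ofReal (Real.exp (lam * t)) *
          Y.lpricing S t (fun z => ENNReal.ofReal (π z) * F z) y := by
      funext y
      rw [hS.lintegral_eigenTransition hπ t y hF.aemeasurable, ← mul_assoc,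
        ← ENNReal.ofReal_mul (hπ.pos y).le, mul_div_cancel₀ _ (hπ.pos y).ne']
    rw [hS.lintegral_eigenTransition hπ s x (hS.aemeasurable_lintegral_eigenTransition hπ t hF _),
      hS.lintegral_eigenTransition hπ (s + t) x hF.aemeasurable, e,
      ← hS.lpricing_lpricing s t hm, NNReal.coe_add, mul_add,
      Real.exp_add, mul_div_right_comm,
      ENNReal.ofReal_mul (div_nonneg (Real.exp_pos _).le (hπ.pos x).le), mul_assoc]
    congr 1
    simp_rw [lpricing, mul_left_comm _ (ENNReal.ofReal (Real.exp (lam * t)))]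
    rw [lintegral_const_mul' _ _ ENNReal.ofReal_ne_top]

/-- If the eigenvalues are ordered, then the eigenfunctions are proportional as soon as the process
is recurrent under the first eigen-measure. -/
theorem exists_eq_mul_of_le {lam₁ lam₂ : ℝ} {π₁ π₂ : E → ℝ}
    (h₁ : Y.IsPositiveEigenfunction S lam₁ π₁) (h₂ : Y.IsPositiveEigenfunction S lam₂ π₂)
    (hrec : IsRecurrent (Y.eigenTransition S lam₁ π₁)) (hle : lam₁ ≤ lam₂) :
    ∃ c : ℝ, 0 < c ∧ ∀ x, π₂ x = c * π₁ x := by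
  rcases isEmpty_or_nonempty E with hE | ⟨⟨x₀⟩⟩
  · exact ⟨1, one_pos, fun x => hE.elim x⟩
  have hpos : ∀ x, 0 < π₂ x / π₁ x := fun x => div_pos (h₂.pos x) (h₁.pos x)
  obtain ⟨d, hd⟩ := (hS.isMarkovSemigroup h₁).eq_of_isRecurrent hrec
    (h := fun x => ENNReal.ofReal (π₂ x / π₁ x)) (h₂.measurable.div h₁.measurable).ennreal_ofReal
    (fun x => (ENNReal.ofReal_pos.2 (hpos x)).ne') (fun x => ENNReal.ofReal_ne_top)
    (sub_nonneg.2 hle) (fun s x hs => hS.lintegral_eigenTransition_div h₁ h₂ hs x)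
  refine ⟨π₂ x₀ / π₁ x₀, hpos x₀, fun x => ?_⟩
  rw [← div_eq_iff (h₁.pos x).ne']
  exact (ENNReal.ofReal_eq_ofReal_iff (hpos x).le (hpos x₀).le).1 ((hd x).trans (hd x₀).symm)

end IsPricingKernel

end BorelRightProcess

end

theorem theorem3p1 {Ω : Type*} {E : Type*} [MeasurableSpace Ω] [TopologicalSpace E]
    [MeasurableSpace E] (Y : BorelRightProcess Ω E) (S : ℝ≥0 → Ω → ℝ)
    (hS : Y.IsPricingKernel S) (π₁ π₂ : E → ℝ)
    (h₁ : Y.IsRecurrentEigenfunction S π₁) (h₂ : Y.IsRecurrentEigenfunction S π₂) :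
    ∃ c : ℝ, 0 < c ∧ ∀ x, π₂ x = c * π₁ x := by
  obtain ⟨lam₁, he₁, hr₁⟩ := h₁
  obtain ⟨lam₂, he₂, hr₂⟩ := h₂
  -- The ratio is supermedian only when its denominator belongs to the smaller eigenvalue, so
  -- recurrence is used under that eigen-measure.
  rcases le_total lam₁ lam₂ with hle | hle
  · exact hS.exists_eq_mul_of_le he₁ he₂ hr₁ hle
  · obtain ⟨c, hc, h⟩ := hS.exists_eq_mul_of_le he₂ he₁ hr₂ hle
    exact ⟨c⁻¹, inv_pos.2 hc, fun x => by rw [h x, inv_mul_cancel_left₀ hc.ne']⟩
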